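/- \textbf{Theorem (equalizer rule for the network CuSum-AC algorithm).} There are $M$ sensors. For each sensor $m$ let $f_{0,m}, f_{1,m}$ be probability densities on $\mathbb{R}$ (with respect to Lebesgue measure) with $0<\mathbf I(f_{1,m}\|f_{0,m})<\infty$ and $0<\mathbf I(f_{0,m}\|f_{1,m})<\infty$, where $\mathbf I$ is the Kullback--Leibler divergence. For a change time $\nu\ge 1$, under the probability measure $\mathbb P_\nu$ the observations $X_{m,k}$ ($1\le m\le M$, $k\ge 1$) are independent, and $X_{m,k}$ has density $f_{0,m}$ if $k<\nu$ and $f_{1,m}$ if $k\ge\nu$. Write $\mathbb P_{0,m},\mathbb P_{1,m}$ for the laws on $\mathbb R$ with densities $f_{0,m},f_{1,m}$. A censoring strategy is a measurable map $\psi:\mathbb R\to\{0,1\}$; the observation $x$ is sent if $\gamma=\psi(x)=1$. For sensor $m$ put $$\ell_m^{\psi}(\gamma,x)=\gamma\ln\frac{f_{1,m}(x)}{f_{0,m}(x)}+(1-\gamma)\ln\frac{\mathbb P_{1,m}\{\psi=0\}}{\mathbb P_{0,m}\{\psi=0\}},$$ and for $0<e\le 1$ let $\psi_m^*(e)$ be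 a maximizer of $\int \ell_m^{\psi}(\psi(x),x)\,f_{1,m}(x)\,dx$ over all censoring strategies $\psi$ with $\mathbb P_{0,m}\{\psi=1\}=e$. Fix thresholds $a_1<a$ with $a>0$ and rates $0<\epsilon_m\le 1$. The network CuSum-AC algorithm starts from $s_0=0$; at time $k\ge1$ sensor $m$ uses $\psi_{m,k}=\psi_m^*(1)$ if $s_{k-1}\ge a_1$ and $\psi_{m,k}=\psi_m^*(\epsilon_m)$ if $s_{k-1}<a_1$, so that $\gamma_{m,k}=\psi_{m,k}(X_{m,k})$, and $$\tilde s_k=\max\Big\{0,\;s_{k-1}+\sum_{m=1}^M \ell_m^{\psi_{m,k}}(\gamma_{m,k},X_{m,k})\Big\},\qquad s_k=\begin{cases}a_1,& s_{k-1}<a_1\le \tilde s_k,\\ \tilde s_k,&\text{otherwise.}\end{cases}$$ Let $T=\inf\{k\ge1: s_k\ge a\}$ (with $\inf\emptyset=\infty$), let $\mathcal I_n$ be the $\sigma$-algebra generated by all $(\gamma_{m,k},\gamma_{m,k}X_{m,k})$ with $1\le k\le n$ and $1\le m\le M$, and let $$d_L=\sup_{1\le\nu<\infty}\operatorname{ess\,sup}\;\mathbb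 E_\nu\big[(T-\nu+1)^+\,\big|\,\mathcal I_{\nu-1}\big]\in[0,\infty]$$ be Lorden's detection delay, the essential supremum being taken with respect to $\mathbb P_\nu$. Then $T$ is a stopping time, i.e. $\{T=k\}\in\mathcal I_k$ for every $k\ge 1$, and it is an equalizer rule: for every $\nu\ge 1$, $$d_L=\operatorname{ess\,sup}\;\mathbb E_\nu\big[(T-\nu+1)^+\,\big|\,\mathcal I_{\nu-1}\big].$$ -/

import Mathlib

open MeasureTheory ProbabilityTheory
open scoped ENNReal

noncomputable section

namespace CensoredDetection

/-- `f` is a probability density function on `ℝ` with respect to Lebesgue measure. -/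
structure IsPDF (f : ℝ → ℝ) : Prop where
  measurable : Measurable f
  nonneg : ∀ x, 0 ≤ f x
  lintegral_eq_one : ∫⁻ x, ENNReal.ofReal (f x) = 1

/-- The law on `ℝ` with density `f`. -/
def pdfMeasure (f : ℝ → ℝ) : Measure ℝ :=
  volume.withDensity fun x => ENNReal.ofReal (f x)

/-- The log-likelihood ratio `ℓ^ψ(γ, x)` of a censored observation: the usual log-likelihood ratio
if the observation is sent (`γ = true`), and the log-ratio of the post- and pre-change
probabilities of not sending if it is not sent (`γ = false`). -/
def censoredLLR (f₀ f₁ : ℝ → ℝ) (ψ : ℝ → Bool) (γ : Bool) (x : ℝ) : ℝ :=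
  if γ = true then Real.log (f₁ x / f₀ x)
  else Real.log ((pdfMeasure f₁).real {y | ψ y = false} / (pdfMeasure f₀).real {y | ψ y = false})

/-- The post-censoring Kullback-Leibler divergence `I^ψ(f₁ ‖ f₀) = E₁[ℓ^ψ(γ₁, X₁)]`. -/
def censoredKL (f₀ f₁ : ℝ → ℝ) (ψ : ℝ → Bool) : ℝ :=
  ∫ x, censoredLLR f₀ f₁ ψ (ψ x) x ∂(pdfMeasure f₁)

/-- The censoring strategies whose pre-change communication rate is exactly `e`. -/
def censoringClass (f₀ : ℝ → ℝ) (e : ℝ) : Set (ℝ → Bool) :=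
  {ψ | Measurable ψ ∧ (pdfMeasure f₀).real {x | ψ x = true} = e}

/-- `ψ` is a strategy `ψ*(e)`: it maximizes the post-censoring divergence among the strategies
of communication rate `e`. -/
def IsOptimalCensoring (f₀ f₁ : ℝ → ℝ) (e : ℝ) (ψ : ℝ → Bool) : Prop :=
  ψ ∈ censoringClass f₀ e ∧ IsMaxOn (censoredKL f₀ f₁) (censoringClass f₀ e) ψ

/-- The observations `X m k` (sensor `m`, time `k = 1, 2, …`) of a network of `M` sensors under
the measure `P` for which the change happens at time `ν`: all of them are independent, and
`X m k` has density `f₀ m` if `k < ν` and density `f₁ m` if `ν ≤ k`. -/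
structure IsChangeModel {Ω : Type*} [MeasurableSpace Ω] {M : ℕ} (f₀ f₁ : Fin M → ℝ → ℝ)
    (X : Fin M → ℕ+ → Ω → ℝ) (ν : ℕ+) (P : Measure Ω) : Prop where
  isProbabilityMeasure : IsProbabilityMeasure P
  indep : iIndepFun (fun p : Fin M × ℕ+ => X p.1 p.2) P
  law_before : ∀ m, ∀ k < ν, P.map (X m k) = pdfMeasure (f₀ m)
  law_after : ∀ m, ∀ k ≥ ν, P.map (X m k) = pdfMeasure (f₁ m)

/-- The censoring strategy used at sensor `m` at the next time instant when the current value of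
the detection statistic is `s`. -/
def activeStrategy {M : ℕ} (ψFull ψCens : Fin M → ℝ → Bool) (a₁ s : ℝ) (m : Fin M) : ℝ → Bool :=
  if a₁ ≤ s then ψFull m else ψCens m

/-- The unreset update `max {0, s + ∑ₘ ℓ^{ψₘ}(γₘ, xₘ)}` of the detection statistic `s` after the
sensors have observed `x`. -/
def rawUpdate {M : ℕ} (f₀ f₁ : Fin M → ℝ → ℝ) (ψFull ψCens : Fin M → ℝ → Bool) (a₁ s : ℝ)
    (x : Fin M → ℝ) : ℝ :=
  max 0 (s + ∑ m, censoredLLR (f₀ m) (f₁ m) (activeStrategy ψFull ψCens a₁ s m)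
    (activeStrategy ψFull ψCens a₁ s m (x m)) (x m))

/-- One step of the network CuSum-AC recursion: the raw update, reset to `a₁` when the threshold
`a₁` is crossed from below. -/
def update {M : ℕ} (f₀ f₁ : Fin M → ℝ → ℝ) (ψFull ψCens : Fin M → ℝ → Bool) (a₁ s : ℝ)
    (x : Fin M → ℝ) : ℝ :=
  if s < a₁ ∧ a₁ ≤ rawUpdate f₀ f₁ ψFull ψCens a₁ s x then a₁
  else rawUpdate f₀ f₁ ψFull ψCens a₁ s x

/-- The detection statistic `s_k` of the network CuSum-AC algorithm, with `s_0 = 0`. -/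
def statistic {Ω : Type*} {M : ℕ} (f₀ f₁ : Fin M → ℝ → ℝ) (ψFull ψCens : Fin M → ℝ → Bool)
    (a₁ : ℝ) (X : Fin M → ℕ+ → Ω → ℝ) : ℕ → Ω → ℝ
  | 0, _ => 0
  | k + 1, ω => update f₀ f₁ ψFull ψCens a₁ (statistic f₀ f₁ ψFull ψCens a₁ X k ω)
      (fun m => X m k.succPNat ω)

/-- The indicator `γ_{m,k} = ψ_{m,k}(X_{m,k})` that sensor `m` sends its observation at time `k`,
where `ψ_{m,k}` is determined by `s_{k-1}`. -/
def sent {Ω : Type*} {M : ℕ} (f₀ f₁ : Fin M → ℝ → ℝ) (ψFull ψCens : Fin M → ℝ → Bool)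
    (a₁ : ℝ) (X : Fin M → ℕ+ → Ω → ℝ) (m : Fin M) (k : ℕ+) (ω : Ω) : Bool :=
  activeStrategy ψFull ψCens a₁ (statistic f₀ f₁ ψFull ψCens a₁ X (k.natPred) ω) m (X m k ω)

/-- The σ-algebra generated by the information available at the fusion center at time `n`, i.e.
by all pairs `(γ_{m,k}, γ_{m,k} X_{m,k})` with `1 ≤ k ≤ n`. -/
def information {Ω : Type*} {M : ℕ} (f₀ f₁ : Fin M → ℝ → ℝ) (ψFull ψCens : Fin M → ℝ → Bool)
    (a₁ : ℝ) (X : Fin M → ℕ+ → Ω → ℝ) (n : ℕ) : MeasurableSpace Ω :=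
  ⨆ (m : Fin M) (k : ℕ+) (_ : (k : ℕ) ≤ n),
    MeasurableSpace.comap
      (fun ω => (sent f₀ f₁ ψFull ψCens a₁ X m k ω,
        if sent f₀ f₁ ψFull ψCens a₁ X m k ω = true then X m k ω else 0))
      (inferInstance : MeasurableSpace (Bool × ℝ))

/-- The CuSum-AC stopping time `inf {k ≥ 1 : s_k ≥ a}`, with value `⊤` if `a` is never reached. -/
def stoppingTime {Ω : Type*} {M : ℕ} (f₀ f₁ : Fin M → ℝ → ℝ) (ψFull ψCens : Fin M → ℝ → Bool)
    (a₁ a : ℝ) (X : Fin M → ℕ+ → Ω → ℝ) (ω : Ω) : ℕ∞ :=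
  ⨅ (k : ℕ+) (_ : a ≤ statistic f₀ f₁ ψFull ψCens a₁ X k ω), ((k : ℕ) : ℕ∞)

/-- `ess sup E_ν[(T - ν + 1)⁺ | I_{ν-1}]`, the worst-case average detection delay at change time
`ν`, as an extended nonnegative number. Here `P ν` is the law with change at `ν`, and `I n` is the
information at time `n`. Truncated subtraction in `ℕ∞` gives the positive part. -/
def worstDelay {Ω : Type*} [MeasurableSpace Ω] (P : ℕ+ → Measure Ω) (I : ℕ → MeasurableSpace Ω)
    (T : Ω → ℕ∞) (ν : ℕ+) : ℝ≥0∞ :=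
  essSup (condLExp (I ((ν : ℕ) - 1)) (P ν) fun ω => ((T ω + 1 - ((ν : ℕ) : ℕ∞) : ℕ∞) : ℝ≥0∞)) (P ν)

/-- Lorden's detection delay: the supremum of the worst-case delays over all change times. -/
def lordenDelay {Ω : Type*} [MeasurableSpace Ω] (P : ℕ+ → Measure Ω) (I : ℕ → MeasurableSpace Ω)
    (T : Ω → ℕ∞) : ℝ≥0∞ :=
  ⨆ ν : ℕ+, worstDelay P I T ν

end CensoredDetection

end

noncomputable section

namespace CensoredDetection

section Chain

variable {E : Type*} [MeasurableSpace E]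

/-- For the Markov chain with transitions `s ↦ u s x`, `x ∼ μ`, started at `s`: the probability that
the first `i + 1` states, the starting state included, are all below `a`. -/
def survival (u : ℝ → E → ℝ) (a : ℝ) (μ : Measure E) : ℕ → ℝ → ℝ≥0∞
  | 0, s => if s < a then 1 else 0
  | i + 1, s => if s < a then ∫⁻ x, survival u a μ i (u s x) ∂μ else 0

/-- The expected number of steps until the chain started at `s` reaches `a`. -/
def meanExit (u : ℝ → E → ℝ) (a : ℝ) (μ : Measure E) (s : ℝ) : ℝ≥0∞ :=
  ∑' i, survival u a μ i s

variable {u : ℝ → E → ℝ} {a : ℝ} {μ : Measure E}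

lemma survival_of_le {s : ℝ} (h : a ≤ s) (i : ℕ) : survival u a μ i s = 0 := by
  cases i <;> simp [survival, h.not_gt]

lemma measurable_survival [SFinite μ] (hu : Measurable (Function.uncurry u)) (i : ℕ) :
    Measurable (survival u a μ i) := by
  induction i with
  | zero => exact Measurable.ite measurableSet_Iio measurable_const measurable_const
  | succ i ih =>
    refine Measurable.ite measurableSet_Iio ?_ measurable_const
    exact Measurable.lintegral_prod_right' (f := fun p : ℝ × E => survival u a μ i (u p.1 p.2))
      (ih.comp hu)

lemma measurable_meanExit [SFinite μ] (hu : Measurable (Function.uncurry u)) :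
    Measurable (meanExit u a μ) :=
  Measurable.tsum (measurable_survival hu)

lemma survival_le_one [IsProbabilityMeasure μ] (i : ℕ) (s : ℝ) : survival u a μ i s ≤ 1 := by
  induction i generalizing s with
  | zero => rw [survival]; split_ifs <;> simp
  | succ i ih =>
    rw [survival]
    split_ifs
    · exact (lintegral_mono fun x => ih (u s x)).trans (by simp)
    · simp

/-- The expected exit time truncated at `n`. -/
def truncExit (u : ℝ → E → ℝ) (a : ℝ) (μ : Measure E) (n : ℕ) (s : ℝ) : ℝ≥0∞ :=
  ∑ i ∈ Finset.range n, survival u a μ i s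

lemma truncExit_of_le {s : ℝ} (h : a ≤ s) (n : ℕ) : truncExit u a μ n s = 0 := by
  simp [truncExit, survival_of_le h]

lemma truncExit_succ [SFinite μ] (hu : Measurable (Function.uncurry u)) {s : ℝ} (h : s < a)
    (n : ℕ) : truncExit u a μ (n + 1) s = 1 + ∫⁻ x, truncExit u a μ n (u s x) ∂μ := by
  have hm (i : ℕ) : Measurable fun x => survival u a μ i (u s x) :=
    (measurable_survival hu i).comp (hu.comp measurable_prodMk_left)
  simp only [truncExit]
  rw [Finset.sum_range_succ', lintegral_finsetSum _ fun i _ => hm i, add_comm]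
  simp [survival, h]

lemma truncExit_succ_le [IsProbabilityMeasure μ] (n : ℕ) (s : ℝ) :
    truncExit u a μ (n + 1) s ≤ 1 + truncExit u a μ n s := by
  rw [truncExit, Finset.sum_range_succ, add_comm]
  exact add_le_add_left (survival_le_one n s) _

lemma antitone_truncExit [IsProbabilityMeasure μ] (hu : Measurable (Function.uncurry u)) {a₁ : ℝ}
    (ha₁ : a₁ < a) (hbelow : ∀ x, MonotoneOn (u · x) (Set.Iio a₁))
    (habove : ∀ x, MonotoneOn (u · x) (Set.Ici a₁)) (hreset : ∀ s < a₁, ∀ x, u s x ≤ a₁) (n : ℕ) :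
    Antitone (truncExit u a μ n) := by
  induction n with
  | zero => intro s t _; simp [truncExit]
  | succ n ih =>
    have key {s t : ℝ} (hst : s ≤ t) (h : ∀ x, u s x ≤ u t x) :
        truncExit u a μ (n + 1) t ≤ truncExit u a μ (n + 1) s := by
      rcases le_or_gt a t with hat | hta
      · simp [truncExit_of_le hat]
      · rw [truncExit_succ hu hta, truncExit_succ hu (hst.trans_lt hta)]
        exact add_le_add_right (lintegral_mono fun x => ih (h x)) _
    intro s t hst
    rcases lt_or_ge t a₁ with ht | ht
    · exact key hst fun x => hbelow x (hst.trans_lt ht) ht hst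
    rcases le_or_gt a₁ s with hs | hs
    · exact key hst fun x => habove x hs ht hst
    calc truncExit u a μ (n + 1) t ≤ truncExit u a μ (n + 1) a₁ :=
          key ht fun x => habove x Set.self_mem_Ici ht ht
      _ ≤ 1 + truncExit u a μ n a₁ := truncExit_succ_le n a₁
      _ = 1 + ∫⁻ _, truncExit u a μ n a₁ ∂μ := by simp
      _ ≤ 1 + ∫⁻ x, truncExit u a μ n (u s x) ∂μ :=
          add_le_add_right (lintegral_mono fun x => ih (hreset s hs x)) _
      _ = truncExit u a μ (n + 1) s := (truncExit_succ hu (hs.trans ha₁) n).symm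

lemma antitone_meanExit [IsProbabilityMeasure μ] (hu : Measurable (Function.uncurry u)) {a₁ : ℝ}
    (ha₁ : a₁ < a) (hbelow : ∀ x, MonotoneOn (u · x) (Set.Iio a₁))
    (habove : ∀ x, MonotoneOn (u · x) (Set.Ici a₁)) (hreset : ∀ s < a₁, ∀ x, u s x ≤ a₁) :
    Antitone (meanExit u a μ) := by
  intro s t hst
  simp only [meanExit, ENNReal.tsum_eq_iSup_nat]
  exact iSup_mono fun n => antitone_truncExit hu ha₁ hbelow habove hreset n hst

/-- The Markov property for one step driven by an independent input. -/
lemma setLIntegral_comp_transition {Ω : Type*} {F m₀ : MeasurableSpace Ω} {P : Measure Ω}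
    [IsProbabilityMeasure P] (hF : F ≤ m₀) {S : Ω → ℝ}
    (hS : Measurable[F] S) {Y : Ω → E} (hY : Measurable Y)
    (hind : Indep F (MeasurableSpace.comap Y inferInstance) P) (hu : Measurable (Function.uncurry u))
    {φ : ℝ → ℝ≥0∞} (hφ : Measurable φ) {B : Set Ω} (hB : MeasurableSet[F] B) :
    ∫⁻ ω in B, φ (u (S ω) (Y ω)) ∂P = ∫⁻ ω in B, ∫⁻ x, φ (u (S ω) x) ∂(P.map Y) ∂P := by
  let W : Ω → ℝ × ℝ≥0∞ := fun ω => (S ω, B.indicator 1 ω)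
  have hWF : Measurable[F] W := hS.prodMk ((@measurable_const _ _ _ F 1).indicator hB)
  have hW : Measurable W := hWF.mono hF le_rfl
  have hWY : IndepFun W Y P := indep_of_indep_of_le_left hind hWF.comap_le
  have := Measure.isProbabilityMeasure_map (μ := P) hY.aemeasurable
  have hg : Measurable fun p : (ℝ × ℝ≥0∞) × E => p.1.2 * φ (u p.1.1 p.2) :=
    (measurable_snd.comp measurable_fst).mul
      (hφ.comp (hu.comp ((measurable_fst.comp measurable_fst).prodMk measurable_snd)))
  have hjoint := (indepFun_iff_map_prod_eq_prod_map_map hW.aemeasurable hY.aemeasurable).1 hWY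
  have h1 : ∫⁻ ω, (W ω).2 * φ (u (W ω).1 (Y ω)) ∂P
      = ∫⁻ ω, ∫⁻ x, (W ω).2 * φ (u (W ω).1 x) ∂(P.map Y) ∂P := by
    rw [← lintegral_map hg (hW.prodMk hY), hjoint, lintegral_prod _ hg.aemeasurable,
      lintegral_map hg.lintegral_prod_right' hW]
  have hsec (s : ℝ) : Measurable fun x => φ (u s x) := hφ.comp (hu.comp measurable_prodMk_left)
  rw [← lintegral_indicator (hF _ hB), ← lintegral_indicator (hF _ hB)]
  convert h1 using 2
  · ext ω
    by_cases h : ω ∈ B <;> simp [W, h]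
  · ext ω
    by_cases h : ω ∈ B <;> simp [W, h]

end Chain

lemma IsPDF.isProbabilityMeasure {f : ℝ → ℝ} (hf : IsPDF f) :
    IsProbabilityMeasure (pdfMeasure f) :=
  ⟨by rw [pdfMeasure, withDensity_apply _ .univ, Measure.restrict_univ, hf.lintegral_eq_one]⟩

/-- Under the pre-change law, a censored log-likelihood ratio is nonpositive with positive
probability. -/
lemma measure_censoredLLR_nonpos_ne_zero {f₀ f₁ : ℝ → ℝ} (hf₀ : IsPDF f₀) (hf₁ : IsPDF f₁)
    {ψ : ℝ → Bool} (hψ : Measurable ψ) :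
    pdfMeasure f₀ {x | censoredLLR f₀ f₁ ψ (ψ x) x ≤ 0} ≠ 0 := by
  have := hf₀.isProbabilityMeasure
  have := hf₁.isProbabilityMeasure
  intro h0
  set A : Set ℝ := {x | ψ x = true} with hA
  set B : Set ℝ := {x | ψ x = false} with hB
  have hAm : MeasurableSet A := hψ (measurableSet_singleton true)
  have hAB : Aᶜ = B := by ext x; simp [hA, hB]
  have hsum (f : ℝ → ℝ) [IsProbabilityMeasure (pdfMeasure f)] :
      (pdfMeasure f).real A + (pdfMeasure f).real B = 1 := by
    rw [← hAB, probReal_add_probReal_compl hAm]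
  have hA01 : (pdfMeasure f₁).real A ≤ (pdfMeasure f₀).real A ∧ 0 < (pdfMeasure f₀).real A := by
    have s0 := hsum f₀
    have s1 := hsum f₁
    have n0 : 0 ≤ (pdfMeasure f₁).real A := measureReal_nonneg
    have n1 : 0 ≤ (pdfMeasure f₁).real B := measureReal_nonneg
    by_cases h : (pdfMeasure f₀).real B = 0
    · constructor <;> linarith
    · have : (pdfMeasure f₀).real B < (pdfMeasure f₁).real B := by
        by_contra hle
        refine h ((measureReal_eq_zero_iff (by finiteness)).2 (measure_mono_null ?_ h0))
        intro x hx
        have hx' : ψ x = false := hx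
        simp only [Set.mem_ofPred_eq, censoredLLR, hx', Bool.false_eq_true, if_false]
        exact Real.log_nonpos (by positivity)
          (div_le_one_of_le₀ (not_lt.1 hle) measureReal_nonneg)
      constructor <;> linarith
  have hA0 : pdfMeasure f₀ A ≠ 0 := fun h => by simp [measureReal_def, h] at hA01
  have hA10 : pdfMeasure f₁ A ≤ pdfMeasure f₀ A :=
    (ENNReal.toReal_le_toReal (by finiteness) (by finiteness)).1 hA01.1
  let C : Set ℝ := A ∩ {x | f₀ x < f₁ x}
  have hCm : MeasurableSet C := hAm.inter (measurableSet_lt hf₀.measurable hf₁.measurable)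
  have hC0 : pdfMeasure f₀ C = pdfMeasure f₀ A := by
    refine le_antisymm (measure_mono Set.inter_subset_left) ?_
    have hsub : A ⊆ C ∪ {x | censoredLLR f₀ f₁ ψ (ψ x) x ≤ 0} := by
      intro x hx
      by_cases hlt : f₀ x < f₁ x
      · exact Or.inl ⟨hx, hlt⟩
      · right
        have hx' : ψ x = true := hx
        simp only [Set.mem_ofPred_eq, censoredLLR, hx', if_true]
        exact Real.log_nonpos (div_nonneg (hf₁.nonneg x) (hf₀.nonneg x))
          (div_le_one_of_le₀ (not_lt.1 hlt) (hf₀.nonneg x))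
    calc _ ≤ _ := measure_mono hsub
      _ ≤ _ := measure_union_le _ _
      _ = _ := by rw [h0, add_zero]
  have hlt : pdfMeasure f₀ C < pdfMeasure f₁ C := by
    have hvol : volume C ≠ 0 := fun h =>
      hA0 (hC0 ▸ withDensity_absolutelyContinuous volume _ h)
    have hfin : pdfMeasure f₀ C ≠ ⊤ := by finiteness
    rw [pdfMeasure, withDensity_apply _ hCm] at hfin
    rw [pdfMeasure, pdfMeasure, withDensity_apply _ hCm, withDensity_apply _ hCm]
    refine setLIntegral_strict_mono hCm hvol hf₁.measurable.ennreal_ofReal hfin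
      (Filter.Eventually.of_forall fun x hx => ?_)
    exact (ENNReal.ofReal_lt_ofReal_iff_of_nonneg (hf₀.nonneg x)).2 hx.2
  exact absurd ((hlt.trans_le (measure_mono Set.inter_subset_left)).trans_le (hA10.trans hC0.ge))
    (lt_irrefl _)

section Statistic

variable {Ω : Type*} {M : ℕ} {f₀ f₁ : Fin M → ℝ → ℝ} {ψFull ψCens : Fin M → ℝ → Bool} {a₁ a : ℝ}
  {X : Fin M → ℕ+ → Ω → ℝ}

lemma measurable_activeStrategy {G : MeasurableSpace Ω} (hF : ∀ m, Measurable (ψFull m))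
    (hC : ∀ m, Measurable (ψCens m)) {S Z : Ω → ℝ} (hS : Measurable S) (hZ : Measurable Z)
    (m : Fin M) : Measurable fun ω => activeStrategy ψFull ψCens a₁ (S ω) m (Z ω) := by
  have : (fun ω => activeStrategy ψFull ψCens a₁ (S ω) m (Z ω)) =
      fun ω => if a₁ ≤ S ω then ψFull m (Z ω) else ψCens m (Z ω) := by
    ext ω; rw [activeStrategy]; split_ifs <;> rfl
  rw [this]
  exact Measurable.ite (measurableSet_le measurable_const hS) ((hF m).comp hZ) ((hC m).comp hZ)

lemma measurable_censoredLLR {G : MeasurableSpace Ω} (hf₀ : ∀ m, Measurable (f₀ m))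
    (hf₁ : ∀ m, Measurable (f₁ m)) {S Z : Ω → ℝ} {γ : Ω → Bool} (hS : Measurable S)
    (hγ : Measurable γ) (hZ : Measurable Z) (m : Fin M) :
    Measurable fun ω =>
      censoredLLR (f₀ m) (f₁ m) (activeStrategy ψFull ψCens a₁ (S ω) m) (γ ω) (Z ω) := by
  let c (ψ : ℝ → Bool) : ℝ := Real.log
    ((pdfMeasure (f₁ m)).real {y | ψ y = false} / (pdfMeasure (f₀ m)).real {y | ψ y = false})
  have : (fun ω => censoredLLR (f₀ m) (f₁ m) (activeStrategy ψFull ψCens a₁ (S ω) m) (γ ω) (Z ω)) =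
      fun ω => if γ ω = true then Real.log (f₁ m (Z ω) / f₀ m (Z ω))
        else if a₁ ≤ S ω then c (ψFull m) else c (ψCens m) := by
    ext ω
    rw [censoredLLR, activeStrategy]
    split_ifs <;> rfl
  rw [this]
  refine Measurable.ite (hγ (measurableSet_singleton true)) ?_ ?_
  · exact Real.measurable_log.comp (((hf₁ m).comp hZ).div ((hf₀ m).comp hZ))
  · exact Measurable.ite (measurableSet_le measurable_const hS) measurable_const measurable_const

lemma measurable_rawUpdate {G : MeasurableSpace Ω} (hf₀ : ∀ m, Measurable (f₀ m))
    (hf₁ : ∀ m, Measurable (f₁ m)) (hF : ∀ m, Measurable (ψFull m))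
    (hC : ∀ m, Measurable (ψCens m)) {S : Ω → ℝ} {x : Ω → Fin M → ℝ} (hS : Measurable S)
    (hx : Measurable x) :
    Measurable fun ω => rawUpdate f₀ f₁ ψFull ψCens a₁ (S ω) (x ω) := by
  have hxm (m) : Measurable fun ω => x ω m := (measurable_pi_apply m).comp hx
  exact measurable_const.max (hS.add (Finset.measurable_sum _ fun m _ =>
    measurable_censoredLLR hf₀ hf₁ hS (measurable_activeStrategy hF hC hS (hxm m) m) (hxm m) m))

lemma measurable_update_of_rawUpdate {G : MeasurableSpace Ω} {S : Ω → ℝ} {x : Ω → Fin M → ℝ}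
    (hS : Measurable S)
    (hr : Measurable fun ω => rawUpdate f₀ f₁ ψFull ψCens a₁ (S ω) (x ω)) :
    Measurable fun ω => update f₀ f₁ ψFull ψCens a₁ (S ω) (x ω) :=
  Measurable.ite ((measurableSet_lt hS measurable_const).inter
    (measurableSet_le measurable_const hr)) measurable_const hr

lemma measurable_uncurry_update (hf₀ : ∀ m, Measurable (f₀ m))
    (hf₁ : ∀ m, Measurable (f₁ m)) (hF : ∀ m, Measurable (ψFull m))
    (hC : ∀ m, Measurable (ψCens m)) :
    Measurable (Function.uncurry (update f₀ f₁ ψFull ψCens a₁)) :=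
  measurable_update_of_rawUpdate measurable_fst
    (measurable_rawUpdate hf₀ hf₁ hF hC measurable_fst measurable_snd)

lemma rawUpdate_le_rawUpdate {s t : ℝ} (h : a₁ ≤ s ↔ a₁ ≤ t) (hst : s ≤ t) (x : Fin M → ℝ) :
    rawUpdate f₀ f₁ ψFull ψCens a₁ s x ≤ rawUpdate f₀ f₁ ψFull ψCens a₁ t x := by
  have hst' : activeStrategy ψFull ψCens a₁ s = activeStrategy ψFull ψCens a₁ t := by
    ext m : 1
    simp only [activeStrategy, h]
  rw [rawUpdate, rawUpdate, hst']
  gcongr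

lemma monotoneOn_update_Iio (x : Fin M → ℝ) :
    MonotoneOn (update f₀ f₁ ψFull ψCens a₁ · x) (Set.Iio a₁) := by
  intro s hs t ht hst
  have hs' : s < a₁ := hs
  have ht' : t < a₁ := ht
  have hraw := rawUpdate_le_rawUpdate (f₀ := f₀) (f₁ := f₁) (ψFull := ψFull) (ψCens := ψCens)
    (iff_of_false hs'.not_ge ht'.not_ge) hst x
  simp only [update, hs', ht', true_and]
  split_ifs <;> linarith

lemma monotoneOn_update_Ici (x : Fin M → ℝ) :
    MonotoneOn (update f₀ f₁ ψFull ψCens a₁ · x) (Set.Ici a₁) := by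
  intro s hs t ht hst
  have hs' : a₁ ≤ s := hs
  have ht' : a₁ ≤ t := ht
  simp only [update, hs'.not_gt, ht'.not_gt, false_and, if_false]
  exact rawUpdate_le_rawUpdate (iff_of_true hs' ht') hst x

lemma update_le_of_lt {s : ℝ} (hs : s < a₁) (x : Fin M → ℝ) :
    update f₀ f₁ ψFull ψCens a₁ s x ≤ a₁ := by
  simp only [update, hs, true_and]
  split_ifs <;> linarith

lemma update_nonneg {s : ℝ} (hs : 0 ≤ s) (x : Fin M → ℝ) :
    0 ≤ update f₀ f₁ ψFull ψCens a₁ s x := by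
  rw [update]
  split_ifs with h
  · exact hs.trans h.1.le
  · exact le_max_left _ _

lemma update_zero_eq_zero {x : Fin M → ℝ}
    (hx : ∀ m, censoredLLR (f₀ m) (f₁ m) (activeStrategy ψFull ψCens a₁ 0 m)
      (activeStrategy ψFull ψCens a₁ 0 m (x m)) (x m) ≤ 0) :
    update f₀ f₁ ψFull ψCens a₁ 0 x = 0 := by
  have hr : rawUpdate f₀ f₁ ψFull ψCens a₁ 0 x = 0 := by
    rw [rawUpdate, zero_add]
    exact max_eq_left (Finset.sum_nonpos fun m _ => hx m)
  rw [update, hr, if_neg fun h => absurd (h.1.trans_le h.2) (lt_irrefl _)]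

lemma statistic_nonneg (k : ℕ) (ω : Ω) : 0 ≤ statistic f₀ f₁ ψFull ψCens a₁ X k ω := by
  induction k with
  | zero => exact le_rfl
  | succ k ih => exact update_nonneg ih _

lemma measurable_statistic {G : MeasurableSpace Ω} (hf₀ : ∀ m, Measurable (f₀ m))
    (hf₁ : ∀ m, Measurable (f₁ m)) (hF : ∀ m, Measurable (ψFull m))
    (hC : ∀ m, Measurable (ψCens m)) {n : ℕ} (hX : ∀ m (k : ℕ+), (k : ℕ) ≤ n → Measurable (X m k))
    {k : ℕ} (hk : k ≤ n) : Measurable (statistic f₀ f₁ ψFull ψCens a₁ X k) := by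
  induction k with
  | zero => exact measurable_const
  | succ k ih =>
    have ih := ih (by lia)
    exact measurable_update_of_rawUpdate ih (measurable_rawUpdate hf₀ hf₁ hF hC ih
      (measurable_pi_lambda _ fun m => hX m _ hk))

lemma censoredLLR_eq_of_sent (g₀ g₁ : ℝ → ℝ) (ψ : ℝ → Bool) (γ : Bool) (x : ℝ) :
    censoredLLR g₀ g₁ ψ γ x = censoredLLR g₀ g₁ ψ γ (if γ = true then x else 0) := by
  cases γ <;> simp [censoredLLR]

lemma measurable_sent_prod {m : Fin M} {k : ℕ+} {n : ℕ} (hk : (k : ℕ) ≤ n) :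
    Measurable[information f₀ f₁ ψFull ψCens a₁ X n] fun ω =>
      (sent f₀ f₁ ψFull ψCens a₁ X m k ω,
        if sent f₀ f₁ ψFull ψCens a₁ X m k ω = true then X m k ω else 0) := by
  refine Measurable.mono (comap_measurable _) ?_ le_rfl
  exact le_iSup_of_le m (le_iSup_of_le k (le_iSup_of_le hk le_rfl))

lemma measurable_statistic_information (hf₀ : ∀ m, Measurable (f₀ m))
    (hf₁ : ∀ m, Measurable (f₁ m)) {n k : ℕ} (hk : k ≤ n) :
    Measurable[information f₀ f₁ ψFull ψCens a₁ X n] (statistic f₀ f₁ ψFull ψCens a₁ X k) := by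
  let G := information f₀ f₁ ψFull ψCens a₁ X n
  induction k with
  | zero => exact measurable_const
  | succ k ih =>
    have ih := ih (by lia)
    have hp (m : Fin M) := measurable_sent_prod (f₀ := f₀) (f₁ := f₁) (ψFull := ψFull)
      (ψCens := ψCens) (a₁ := a₁) (X := X) (m := m) (k := k.succPNat) (n := n) hk
    refine measurable_update_of_rawUpdate (G := G) ih ?_
    refine Measurable.max measurable_const (ih.add (Finset.measurable_sum _ fun m _ => ?_))
    have h := measurable_censoredLLR (G := G) (ψFull := ψFull) (ψCens := ψCens) (a₁ := a₁) hf₀ hf₁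
      ih (measurable_fst.comp (hp m)) (measurable_snd.comp (hp m)) m
    refine Eq.mp (congrArg (fun f => Measurable[G] f) (funext fun ω => ?_)) h
    exact (censoredLLR_eq_of_sent _ _ _ _ _).symm

/-- The σ-algebra generated by all observations up to time `n`. -/
abbrev history (X : Fin M → ℕ+ → Ω → ℝ) (n : ℕ) : MeasurableSpace Ω :=
  ⨆ p ∈ {p : Fin M × ℕ+ | (p.2 : ℕ) ≤ n}, MeasurableSpace.comap (X p.1 p.2) inferInstance

lemma measurable_history {m : Fin M} {k : ℕ+} {n : ℕ} (hk : (k : ℕ) ≤ n) :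
    Measurable[history X n] (X m k) :=
  Measurable.mono (comap_measurable _) (le_iSup₂_of_le (m, k) hk le_rfl) le_rfl

lemma history_mono {n n' : ℕ} (h : n ≤ n') : history X n ≤ history X n' :=
  biSup_mono fun _ hp => le_trans hp h

lemma history_le [m₀ : MeasurableSpace Ω] (hX : ∀ m k, Measurable (X m k)) (n : ℕ) :
    history X n ≤ m₀ :=
  iSup₂_le fun p _ => (hX p.1 p.2).comap_le

lemma information_le_history (hf₀ : ∀ m, Measurable (f₀ m))
    (hf₁ : ∀ m, Measurable (f₁ m)) (hF : ∀ m, Measurable (ψFull m))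
    (hC : ∀ m, Measurable (ψCens m)) (n : ℕ) :
    information f₀ f₁ ψFull ψCens a₁ X n ≤ history X n := by
  refine iSup_le fun m => iSup_le fun k => iSup_le fun hk => ?_
  rw [← measurable_iff_comap_le]
  have hXk : Measurable[history X n] (X m k) := measurable_history hk
  have hS : Measurable[history X n] (statistic f₀ f₁ ψFull ψCens a₁ X k.natPred) :=
    measurable_statistic hf₀ hf₁ hF hC (fun _ _ => measurable_history)
      (by have := k.natPred_add_one; lia)
  have hsent : Measurable[history X n] (sent f₀ f₁ ψFull ψCens a₁ X m k) :=
    measurable_activeStrategy hF hC hS hXk m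
  exact hsent.prodMk (Measurable.ite (hsent (measurableSet_singleton true)) hXk measurable_const)

/-- The event that the statistic stays below `a` up to time `n`. -/
def alive (f₀ f₁ : Fin M → ℝ → ℝ) (ψFull ψCens : Fin M → ℝ → Bool) (a₁ a : ℝ)
    (X : Fin M → ℕ+ → Ω → ℝ) (n : ℕ) : Set Ω :=
  {ω | ∀ k ≤ n, statistic f₀ f₁ ψFull ψCens a₁ X k ω < a}

lemma alive_succ (n : ℕ) : alive f₀ f₁ ψFull ψCens a₁ a X (n + 1) =
    alive f₀ f₁ ψFull ψCens a₁ a X n ∩ {ω | statistic f₀ f₁ ψFull ψCens a₁ X (n + 1) ω < a} := by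
  ext ω
  constructor
  · exact fun h => ⟨fun k hk => h k (by lia), h _ le_rfl⟩
  · rintro ⟨h, h'⟩ k hk
    rcases Nat.le_succ_iff.1 hk with hk | rfl
    exacts [h k hk, h']

lemma measurableSet_alive {G : MeasurableSpace Ω} {n : ℕ}
    (hS : ∀ k ≤ n, Measurable (statistic f₀ f₁ ψFull ψCens a₁ X k)) :
    MeasurableSet (alive f₀ f₁ ψFull ψCens a₁ a X n) := by
  have : alive f₀ f₁ ψFull ψCens a₁ a X n =
      ⋂ k, ⋂ (_ : k ≤ n), {ω | statistic f₀ f₁ ψFull ψCens a₁ X k ω < a} := by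
    ext ω; simp [alive]
  rw [this]
  exact .iInter fun k => .iInter fun hk => measurableSet_lt (hS k hk) measurable_const

lemma lt_stoppingTime_iff (ha : 0 < a) (n : ℕ) (ω : Ω) :
    (n : ℕ∞) < stoppingTime f₀ f₁ ψFull ψCens a₁ a X ω ↔ ω ∈ alive f₀ f₁ ψFull ψCens a₁ a X n := by
  rw [← not_iff_not, not_lt, alive, Set.mem_ofPred_eq]
  push Not
  constructor
  · intro h
    have hlt : stoppingTime f₀ f₁ ψFull ψCens a₁ a X ω < ((n + 1 : ℕ) : ℕ∞) :=
      h.trans_lt (by exact_mod_cast Nat.lt_succ_self n)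
    simp only [stoppingTime, iInf_lt_iff] at hlt
    obtain ⟨k, hk, hkn⟩ := hlt
    exact ⟨k, Nat.lt_succ_iff.1 (by exact_mod_cast hkn), hk⟩
  · rintro ⟨k, hkn, hk⟩
    have hk0 : 0 < k := by
      rcases Nat.eq_zero_or_pos k with rfl | h
      · exact absurd hk ha.not_ge
      · exact h
    exact (iInf₂_le (⟨k, hk0⟩ : ℕ+) hk).trans (by exact_mod_cast hkn)

lemma measurableSet_stoppingTime_eq (ha : 0 < a) (hf₀ : ∀ m, Measurable (f₀ m))
    (hf₁ : ∀ m, Measurable (f₁ m)) (k : ℕ+) :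
    MeasurableSet[information f₀ f₁ ψFull ψCens a₁ X k]
      {ω | stoppingTime f₀ f₁ ψFull ψCens a₁ a X ω = ((k : ℕ) : ℕ∞)} := by
  have : {ω | stoppingTime f₀ f₁ ψFull ψCens a₁ a X ω = ((k : ℕ) : ℕ∞)} =
      alive f₀ f₁ ψFull ψCens a₁ a X k.natPred \ alive f₀ f₁ ψFull ψCens a₁ a X k := by
    ext ω
    rw [Set.mem_sdiff, ← lt_stoppingTime_iff ha, ← lt_stoppingTime_iff ha, Set.mem_ofPred_eq, not_lt]
    have hk := k.natPred_add_one
    generalize stoppingTime f₀ f₁ ψFull ψCens a₁ a X ω = T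
    induction T with
    | top => simp
    | coe t => norm_cast; lia
  rw [this]
  have hk := k.natPred_add_one
  exact MeasurableSet.diff
    (measurableSet_alive fun j hj => measurable_statistic_information hf₀ hf₁ (by lia))
    (measurableSet_alive fun j hj => measurable_statistic_information hf₀ hf₁ hj)

lemma delay_eq_tsum (ha : 0 < a) (ν : ℕ+) (ω : Ω) :
    ((stoppingTime f₀ f₁ ψFull ψCens a₁ a X ω + 1 - ((ν : ℕ) : ℕ∞) : ℕ∞) : ℝ≥0∞) =
      ∑' i : ℕ, (alive f₀ f₁ ψFull ψCens a₁ a X (ν - 1 + i)).indicator 1 ω := by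
  have hν := ν.pos
  have key (i : ℕ) : (alive f₀ f₁ ψFull ψCens a₁ a X (ν - 1 + i)).indicator 1 ω =
      if ((ν - 1 + i : ℕ) : ℕ∞) < stoppingTime f₀ f₁ ψFull ψCens a₁ a X ω then (1 : ℝ≥0∞)
        else 0 := by
    classical
    rw [Set.indicator_apply]
    simp only [lt_stoppingTime_iff ha, Pi.one_apply]
  simp only [key]
  generalize stoppingTime f₀ f₁ ψFull ψCens a₁ a X ω = T
  induction T with
  | top => simp
  | coe t =>
    rw [tsum_eq_sum (s := Finset.range (t + 1 - ν)) fun i hi => if_neg ?_]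
    · rw [Finset.sum_congr rfl fun i hi => if_pos ?_]
      · simp
      · rw [Finset.mem_range] at hi
        norm_cast; lia
    · rw [Finset.mem_range] at hi
      norm_cast; lia

end Statistic

section Model

variable {Ω : Type*} {M : ℕ} {f₀ f₁ : Fin M → ℝ → ℝ} {ψFull ψCens : Fin M → ℝ → Bool} {a₁ a : ℝ}
  {X : Fin M → ℕ+ → Ω → ℝ}

lemma indep_history_next [MeasurableSpace Ω] {P : Measure Ω} (hX : ∀ m k, Measurable (X m k))
    (hind : iIndepFun (fun p : Fin M × ℕ+ => X p.1 p.2) P) (n : ℕ) :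
    Indep (history X n)
      (MeasurableSpace.comap (fun ω m => X m n.succPNat ω) inferInstance) P := by
  have hdisj : Disjoint {p : Fin M × ℕ+ | (p.2 : ℕ) ≤ n} {p | p.2 = n.succPNat} := by
    rw [Set.disjoint_left]
    rintro ⟨m, k⟩ (hk : (k : ℕ) ≤ n) (rfl : k = n.succPNat)
    simp at hk
  have hsplit := indep_iSup_of_disjoint
    (m := fun p : Fin M × ℕ+ => MeasurableSpace.comap (X p.1 p.2) inferInstance)
    (fun p => (hX p.1 p.2).comap_le) hind.iIndep hdisj
  refine indep_of_indep_of_le_right hsplit ?_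
  rw [← measurable_iff_comap_le]
  have hm (m : Fin M) : Measurable[⨆ p ∈ {p : Fin M × ℕ+ | p.2 = n.succPNat},
      MeasurableSpace.comap (X p.1 p.2) inferInstance] (X m n.succPNat) :=
    Measurable.mono (comap_measurable _) (le_iSup₂_of_le (m, n.succPNat) rfl le_rfl) le_rfl
  exact @measurable_pi_lambda _ _ _ (_) _ _ hm

lemma map_observations_eq_pi [MeasurableSpace Ω] {P : Measure Ω} (hX : ∀ m k, Measurable (X m k))
    (hind : iIndepFun (fun p : Fin M × ℕ+ => X p.1 p.2) P) (k : ℕ+) :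
    P.map (fun ω m => X m k ω) = Measure.pi fun m => P.map (X m k) :=
  (hind.precomp (g := fun m : Fin M => (m, k)) fun _ _ h => (Prod.ext_iff.1 h).1).map_fun_eq_pi_map
    fun m => (hX m k).aemeasurable

variable [MeasurableSpace Ω] {P : Measure Ω} {ν : ℕ+}

lemma measure_inter_alive (hf₀ : ∀ m, IsPDF (f₀ m)) (hf₁ : ∀ m, IsPDF (f₁ m))
    (hF : ∀ m, Measurable (ψFull m)) (hC : ∀ m, Measurable (ψCens m))
    (hX : ∀ m k, Measurable (X m k)) (hP : IsChangeModel f₀ f₁ X ν P) (i : ℕ) {k : ℕ}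
    (hk : ν ≤ k + 1) {B : Set Ω} (hB : MeasurableSet[history X k] B) :
    P (B ∩ alive f₀ f₁ ψFull ψCens a₁ a X (k + i)) =
      ∫⁻ ω in B ∩ alive f₀ f₁ ψFull ψCens a₁ a X k,
        survival (update f₀ f₁ ψFull ψCens a₁) a (Measure.pi fun m => pdfMeasure (f₁ m)) i
          (statistic f₀ f₁ ψFull ψCens a₁ X k ω) ∂P := by
  have := hP.isProbabilityMeasure
  have := fun m => (hf₁ m).isProbabilityMeasure
  have hu := measurable_uncurry_update (a₁ := a₁) (fun m => (hf₀ m).measurable)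
    (fun m => (hf₁ m).measurable) hF hC
  have hS (n k : ℕ) (hk : k ≤ n) :
      Measurable[history X n] (statistic f₀ f₁ ψFull ψCens a₁ X k) :=
    measurable_statistic (fun m => (hf₀ m).measurable) (fun m => (hf₁ m).measurable) hF hC
      (fun _ _ => measurable_history) hk
  have hA (n : ℕ) : MeasurableSet[history X n] (alive f₀ f₁ ψFull ψCens a₁ a X n) :=
    measurableSet_alive fun k hk => hS n k hk
  have hle := history_le hX
  induction i generalizing k B with
  | zero =>
    rw [add_zero, ← setLIntegral_one]
    refine setLIntegral_congr_fun (hle k _ (hB.inter (hA k))) fun ω hω => ?_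
    simp [survival, hω.2 k le_rfl]
  | succ i ih =>
    have hBk := hB.inter (hA k)
    rw [show k + (i + 1) = k + 1 + i by ring,
      ih (by lia) (history_mono k.le_succ _ hB), alive_succ, ← Set.inter_assoc,
      Set.inter_comm _ {ω | _}, ← Measure.restrict_restrict
        (measurableSet_lt ((hS _ _ le_rfl).mono (hle _) le_rfl) measurable_const)]
    rw [← lintegral_indicator
      (measurableSet_lt ((hS _ _ le_rfl).mono (hle _) le_rfl) measurable_const)]
    have hY : Measurable fun ω m => X m k.succPNat ω := measurable_pi_lambda _ fun m => hX m _
    have hlaw : P.map (fun ω m => X m k.succPNat ω) = Measure.pi fun m => pdfMeasure (f₁ m) := by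
      rw [map_observations_eq_pi hX hP.indep]
      congr 1
      ext m : 1
      exact hP.law_after m _ (by rw [ge_iff_le, ← PNat.coe_le_coe]; simpa using hk)
    have hstep := setLIntegral_comp_transition (hle k) (hS k k le_rfl) hY
      (indep_history_next hX hP.indep k) hu
      (measurable_survival (a := a) (μ := Measure.pi fun m => pdfMeasure (f₁ m)) hu i) hBk
    rw [hlaw] at hstep
    trans ∫⁻ ω in B ∩ alive f₀ f₁ ψFull ψCens a₁ a X k,
      survival (update f₀ f₁ ψFull ψCens a₁) a (Measure.pi fun m => pdfMeasure (f₁ m)) i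
        (statistic f₀ f₁ ψFull ψCens a₁ X (k + 1) ω) ∂P
    · refine lintegral_congr fun ω => ?_
      rw [Set.indicator_apply_eq_self]
      exact fun h => survival_of_le (not_lt.1 h) i
    · refine hstep.trans (setLIntegral_congr_fun (hle k _ hBk) fun ω hω => ?_)
      simp [survival, hω.2 k le_rfl]

lemma condLExp_delay_ae_eq (hf₀ : ∀ m, IsPDF (f₀ m)) (hf₁ : ∀ m, IsPDF (f₁ m))
    (hF : ∀ m, Measurable (ψFull m)) (hC : ∀ m, Measurable (ψCens m))
    (hX : ∀ m k, Measurable (X m k)) (hP : IsChangeModel f₀ f₁ X ν P) (ha : 0 < a) :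
    (alive f₀ f₁ ψFull ψCens a₁ a X (ν - 1)).indicator (fun ω =>
        meanExit (update f₀ f₁ ψFull ψCens a₁) a (Measure.pi fun m => pdfMeasure (f₁ m))
          (statistic f₀ f₁ ψFull ψCens a₁ X (ν - 1) ω)) =ᵐ[P]
      condLExp (information f₀ f₁ ψFull ψCens a₁ X (ν - 1)) P fun ω =>
        ((stoppingTime f₀ f₁ ψFull ψCens a₁ a X ω + 1 - ((ν : ℕ) : ℕ∞) : ℕ∞) : ℝ≥0∞) := by
  have := hP.isProbabilityMeasure
  have := fun m => (hf₁ m).isProbabilityMeasure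
  have hu := measurable_uncurry_update (a₁ := a₁) (fun m => (hf₀ m).measurable)
    (fun m => (hf₁ m).measurable) hF hC
  have hIH : information f₀ f₁ ψFull ψCens a₁ X (ν - 1) ≤ history X (ν - 1) :=
    information_le_history (fun m => (hf₀ m).measurable) (fun m => (hf₁ m).measurable) hF hC _
  have hS {k : ℕ} (hk : k ≤ ν - 1) :
      Measurable[information f₀ f₁ ψFull ψCens a₁ X (ν - 1)]
        (statistic f₀ f₁ ψFull ψCens a₁ X k) :=
    measurable_statistic_information (fun m => (hf₀ m).measurable) (fun m => (hf₁ m).measurable) hk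
  have hle : information f₀ f₁ ψFull ψCens a₁ X (ν - 1) ≤ ‹MeasurableSpace Ω› :=
    hIH.trans (history_le hX _)
  have hA := measurableSet_alive (a := a) fun k hk => hS (k := k) hk
  have hAn (n : ℕ) : MeasurableSet (alive f₀ f₁ ψFull ψCens a₁ a X n) :=
    measurableSet_alive fun k hk => measurable_statistic (n := n) (fun m => (hf₀ m).measurable)
      (fun m => (hf₁ m).measurable) hF hC (fun m k _ => hX m k) hk
  have hν := ν.pos
  refine ae_eq_condLExp hle P _ (((measurable_meanExit hu).comp (hS le_rfl)).indicator hA)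
    fun B hB => ?_
  simp only [delay_eq_tsum ha]
  rw [setLIntegral_indicator (hle _ hA), Set.inter_comm,
    lintegral_tsum fun i => (measurable_one.indicator (hAn _)).aemeasurable]
  simp only [meanExit]
  have hsurv (i : ℕ) : Measurable fun ω =>
      survival (update f₀ f₁ ψFull ψCens a₁) a (Measure.pi fun m => pdfMeasure (f₁ m)) i
        (statistic f₀ f₁ ψFull ψCens a₁ X (ν - 1) ω) :=
    (measurable_survival hu i).comp ((hS le_rfl).mono hle le_rfl)
  rw [lintegral_tsum fun i => (hsurv i).aemeasurable]
  refine tsum_congr fun i => ?_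
  rw [lintegral_indicator_one (hAn _), Measure.restrict_apply (hAn _), Set.inter_comm _ B]
  exact (measure_inter_alive hf₀ hf₁ hF hC hX hP i (by lia) (hIH _ hB)).symm

/-- The detection statistic stays at `0` until the change with positive probability. -/
lemma measure_statistic_eq_zero_ne_zero (hf₀ : ∀ m, IsPDF (f₀ m)) (hf₁ : ∀ m, IsPDF (f₁ m))
    (hF : ∀ m, Measurable (ψFull m)) (hC : ∀ m, Measurable (ψCens m))
    (hX : ∀ m k, Measurable (X m k)) (hP : IsChangeModel f₀ f₁ X ν P) {n : ℕ} (hn : n < ν) :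
    P {ω | ∀ k ≤ n, statistic f₀ f₁ ψFull ψCens a₁ X k ω = 0} ≠ 0 := by
  have := hP.isProbabilityMeasure
  have := fun m => (hf₀ m).isProbabilityMeasure
  induction n with
  | zero =>
    have : {ω | ∀ k ≤ 0, statistic f₀ f₁ ψFull ψCens a₁ X k ω = 0} = Set.univ := by
      ext ω; simp [statistic]
    rw [this, measure_univ]
    exact one_ne_zero
  | succ n ih =>
    let ψ := activeStrategy ψFull ψCens a₁ 0
    have hψ (m : Fin M) : Measurable (ψ m) :=
      measurable_activeStrategy hF hC measurable_const measurable_id m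
    let L (m : Fin M) : Set ℝ := {x | censoredLLR (f₀ m) (f₁ m) (ψ m) (ψ m x) x ≤ 0}
    have hL (m : Fin M) : MeasurableSet (L m) :=
      measurableSet_le (measurable_censoredLLR (fun m => (hf₀ m).measurable)
        (fun m => (hf₁ m).measurable) measurable_const (hψ m) measurable_id m) measurable_const
    have hL' : MeasurableSet (Set.univ.pi L) := .univ_pi hL
    have hY : Measurable fun ω m => X m n.succPNat ω := measurable_pi_lambda _ fun m => hX m _
    have hlaw : P.map (fun ω m => X m n.succPNat ω) = Measure.pi fun m => pdfMeasure (f₀ m) := by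
      rw [map_observations_eq_pi hX hP.indep]
      congr 1
      ext m : 1
      exact hP.law_before m _ (by rw [← PNat.coe_lt_coe]; simpa using hn)
    have hZ : MeasurableSet[history X n]
        {ω | ∀ k ≤ n, statistic f₀ f₁ ψFull ψCens a₁ X k ω = 0} := by
      have : {ω | ∀ k ≤ n, statistic f₀ f₁ ψFull ψCens a₁ X k ω = 0} =
          ⋂ k, ⋂ (_ : k ≤ n), statistic f₀ f₁ ψFull ψCens a₁ X k ⁻¹' {0} := by
        ext ω; simp
      rw [this]
      exact .iInter fun k => .iInter fun hk => measurable_statistic (fun m => (hf₀ m).measurable)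
        (fun m => (hf₁ m).measurable) hF hC (fun _ _ => measurable_history) hk
        (measurableSet_singleton 0)
    have hprod := (Indep_iff _ _ _).1 (indep_history_next hX hP.indep n) _ _ hZ
      (comap_measurable (fun ω m => X m n.succPNat ω) hL')
    rw [← Measure.map_apply hY hL', hlaw, Measure.pi_pi] at hprod
    have hpos := mul_ne_zero (ih (by lia)) (Finset.prod_ne_zero_iff.2 fun m (_ : m ∈ Finset.univ) =>
      measure_censoredLLR_nonpos_ne_zero (hf₀ m) (hf₁ m) (hψ m))
    rw [← hprod] at hpos
    refine fun h0 => hpos (measure_mono_null ?_ h0)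
    rintro ω ⟨hω, hω'⟩ k hk
    rcases Nat.le_succ_iff.1 hk with hk | rfl
    · exact hω k hk
    · rw [statistic, hω n le_rfl]
      exact update_zero_eq_zero fun m => hω' m trivial

lemma worstDelay_eq_meanExit (hf₀ : ∀ m, IsPDF (f₀ m)) (hf₁ : ∀ m, IsPDF (f₁ m))
    (hF : ∀ m, Measurable (ψFull m)) (hC : ∀ m, Measurable (ψCens m))
    (hX : ∀ m k, Measurable (X m k)) {P : ℕ+ → Measure Ω} (hP : IsChangeModel f₀ f₁ X ν (P ν))
    (ha₁ : a₁ < a) (ha : 0 < a) :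
    worstDelay P (information f₀ f₁ ψFull ψCens a₁ X) (stoppingTime f₀ f₁ ψFull ψCens a₁ a X) ν =
      meanExit (update f₀ f₁ ψFull ψCens a₁) a (Measure.pi fun m => pdfMeasure (f₁ m)) 0 := by
  have := hP.isProbabilityMeasure
  have := fun m => (hf₁ m).isProbabilityMeasure
  have hu := measurable_uncurry_update (a₁ := a₁) (fun m => (hf₀ m).measurable)
    (fun m => (hf₁ m).measurable) hF hC
  have hν := ν.pos
  rw [worstDelay, ← essSup_congr_ae (condLExp_delay_ae_eq hf₀ hf₁ hF hC hX hP ha)]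
  refine le_antisymm (essSup_le_of_ae_le _ (Filter.Eventually.of_forall fun ω => ?_)) ?_
  · refine (Set.indicator_le_self _ _ ω).trans ?_
    exact antitone_meanExit hu ha₁ monotoneOn_update_Iio monotoneOn_update_Ici
      (fun s hs => update_le_of_lt hs) (statistic_nonneg _ ω)
  · by_contra hlt
    refine measure_statistic_eq_zero_ne_zero (a₁ := a₁) (n := ν - 1) hf₀ hf₁ hF hC hX hP (by lia)
      (measure_mono_null (fun ω hω => ?_) (ae_lt_of_essSup_lt (not_le.1 hlt)))
    have hω' : ω ∈ alive f₀ f₁ ψFull ψCens a₁ a X (ν - 1) := fun k hk => (hω k hk).trans_lt ha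
    have h0 : statistic f₀ f₁ ψFull ψCens a₁ X (ν - 1) ω = 0 := hω _ le_rfl
    simp [Set.indicator_of_mem hω', h0]

end Model

end CensoredDetection

end

theorem theorem3 {M : ℕ} {Ω : Type*} [MeasurableSpace Ω]
    (f₀ f₁ : Fin M → ℝ → ℝ)
    (hf₀ : ∀ m, CensoredDetection.IsPDF (f₀ m)) (hf₁ : ∀ m, CensoredDetection.IsPDF (f₁ m))
    (hKL₁₀ : ∀ m,
      0 < InformationTheory.klDiv (CensoredDetection.pdfMeasure (f₁ m))
          (CensoredDetection.pdfMeasure (f₀ m)) ∧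
        InformationTheory.klDiv (CensoredDetection.pdfMeasure (f₁ m))
          (CensoredDetection.pdfMeasure (f₀ m)) < ⊤)
    (hKL₀₁ : ∀ m,
      0 < InformationTheory.klDiv (CensoredDetection.pdfMeasure (f₀ m))
          (CensoredDetection.pdfMeasure (f₁ m)) ∧
        InformationTheory.klDiv (CensoredDetection.pdfMeasure (f₀ m))
          (CensoredDetection.pdfMeasure (f₁ m)) < ⊤)
    (X : Fin M → ℕ+ → Ω → ℝ) (hX : ∀ m k, Measurable (X m k))
    (P : ℕ+ → Measure Ω) (hP : ∀ ν, CensoredDetection.IsChangeModel f₀ f₁ X ν (P ν))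
    (a₁ a : ℝ) (ha₁ : a₁ < a) (ha : 0 < a)
    (ε : Fin M → ℝ) (hε : ∀ m, 0 < ε m ∧ ε m ≤ 1)
    (ψFull ψCens : Fin M → ℝ → Bool)
    (hFull : ∀ m, CensoredDetection.IsOptimalCensoring (f₀ m) (f₁ m) 1 (ψFull m))
    (hCens : ∀ m, CensoredDetection.IsOptimalCensoring (f₀ m) (f₁ m) (ε m) (ψCens m)) :
    (∀ k : ℕ+, MeasurableSet[CensoredDetection.information f₀ f₁ ψFull ψCens a₁ X k]
      {ω | CensoredDetection.stoppingTime f₀ f₁ ψFull ψCens a₁ a X ω = ((k : ℕ) : ℕ∞)}) ∧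
    ∀ ν : ℕ+,
      CensoredDetection.lordenDelay P (CensoredDetection.information f₀ f₁ ψFull ψCens a₁ X)
          (CensoredDetection.stoppingTime f₀ f₁ ψFull ψCens a₁ a X) =
        CensoredDetection.worstDelay P (CensoredDetection.information f₀ f₁ ψFull ψCens a₁ X)
          (CensoredDetection.stoppingTime f₀ f₁ ψFull ψCens a₁ a X) ν := by
  have hF := fun m => (hFull m).1.1
  have hC := fun m => (hCens m).1.1
  refine ⟨CensoredDetection.measurableSet_stoppingTime_eq ha (fun m => (hf₀ m).measurable)
    fun m => (hf₁ m).measurable, fun ν => ?_⟩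
  have hdelay := fun ν => CensoredDetection.worstDelay_eq_meanExit hf₀ hf₁ hF hC hX (hP ν) ha₁ ha
  rw [CensoredDetection.lordenDelay, hdelay ν]
  simp only [hdelay, ciSup_const]
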